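/- Setting. Let $\mathcal H:\mathbb R^3\to\mathbb C^{N\times N}$ be a continuous (in general non-Hermitian) Hamiltonian, periodic under a reciprocal lattice $\Lambda$ (any subgroup of $\mathbb R^3$; $\Lambda=\{0\}$ for a continuum model). Let $\hat m$ be the reflection of $\mathbb R^3$ in the plane through the origin orthogonal to a unit vector, and let $\hat M=\hat M^\dagger=\hat M^{-1}\in\mathbb C^{N\times N}$. Assume the mirror-adjoint ($M$-$\dagger$) symmetry $\hat M\,\mathcal H(\hat m\mathbf k)^\dagger\hat M^{-1}=\mathcal H(\mathbf k)$ for all $\mathbf k$. The mirror plane is $\Pi_M=\{\mathbf k:\hat m\mathbf k-\mathbf k\in\Lambda\}$. Definitions. The $M$-$\dagger$-parity of a state $\psi\neq0$ is $\tilde p(\psi)=\operatorname{sign}\big(\langle\psi|\hat M|\psi\rangle/\langle\psi|\psi\rangle\big)\in\{-1,0,1\}$. A (real) order-2 exceptional point (EP2) on $\Pi_M$ is a pair $(\mathbf k_0,E_0)$, $\mathbf k_0\in\Pi_M$, $E_0\in\mathbb R$, such that $E_0$ is an eigenvalue of $\mathcal H(\mathbf k_0)$ of algebraic multiplicity 2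 and geometric multiplicity 1. An order-2 exceptional line on $\Pi_M$ is a continuous, locally injective curve in $\Pi_M$, parametrized by a nondegenerate interval, together with a continuous real energy along it, all of whose points are EP2s at that energy. A pair of bands in the exact phase on a region $R\subseteq\Pi_M$ is a pair of continuous functions $E_1,E_2:R\to\mathbb R$ such that, for every $\mathbf k\in R$, $E_1(\mathbf k)\ne E_2(\mathbf k)$ are eigenvalues of $\mathcal H(\mathbf k)$ of algebraic multiplicity 1. The two bands meet at $(\mathbf k_0,E_0)$ if $\mathbf k_0\in\overline R$ and $E_1(\mathbf k),E_2(\mathbf k)\to E_0$ as $\mathbf k\to\mathbf k_0$ in $R$. Theorem. (i) Let $(\mathbf k_0,E_0)$ be a real EP2 on $\Pi_M$. There is $\varepsilon>0$ such that for every $\mathbf k\in\Pi_M$ with $|\mathbf k-\mathbf k_0|<\varepsilon$ and any two distinct real eigenvalues $E_1\neq E_2$ of $\mathcal H(\mathbf k)$ in $(E_0-\varepsilon,E_0+\varepsilon)$, with eigenvectors $\psi_1,\psi_2$, one has $\tilde p(\psi_1)\neq0$ and $\tilde p(\psi_2)=-\tilde p(\psi_1)$. (ii) An order-2 exceptional line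 on $\Pi_M$ can only be formed by two bands with opposite $M$-$\dagger$-parities in the nearby exact phase: if a pair of bands in the exact phase on a connected region $R\subseteq\Pi_M$ meets at some point of the line, at the energy of the line there, then there is $s\in\{1,-1\}$ such that all eigenvectors of the first band on $R$ have parity $s$ and all eigenvectors of the second band on $R$ have parity $-s$. (iii) (Corollary) Let a pair of bands in the exact phase on a region $R\subseteq\Pi_M$ have the same $M$-$\dagger$-parity at every point of $R$. If they meet at $(\mathbf k_0,E_0)$ with $\mathbf k_0\in\Pi_M$, and $E_0$ is an eigenvalue of $\mathcal H(\mathbf k_0)$ of algebraic multiplicity 2, then this degeneracy is non-defective (the geometric multiplicity of $E_0$ is also 2). -/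

import Mathlib

open Topology Matrix

namespace MirrorAdjoint

/-- Three-dimensional momentum space. -/
abbrev Momentum : Type := EuclideanSpace ℝ (Fin 3)

/-- The mirror operation: reflection in the plane through the origin orthogonal to `n`. -/
noncomputable def mirror (n k : Momentum) : Momentum :=
  (ℝ ∙ n)ᗮ.reflection k

/-- The mirror plane: momenta that are fixed by the mirror modulo the reciprocal lattice `Λ`
(the fixed points of the mirror in the Brillouin zone; `Λ = ⊥` for a continuum model). -/
def mirrorPlane (n : Momentum) (Λ : AddSubgroup Momentum) : Set Momentum :=
  {k | mirror n k - k ∈ Λ}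

/-- Mirror-adjoint symmetry `M H(m k)† M⁻¹ = H(k)`. -/
def MirrorAdjointSymmetric {N : ℕ} (n : Momentum) (M : Matrix (Fin N) (Fin N) ℂ)
    (H : Momentum → Matrix (Fin N) (Fin N) ℂ) : Prop :=
  ∀ k, M * (H (mirror n k))ᴴ * M⁻¹ = H k

/-- `ψ` is a (right) eigenvector of `A` with eigenvalue `E`. -/
def IsEigenstate {N : ℕ} (A : Matrix (Fin N) (Fin N) ℂ) (E : ℂ) (ψ : Fin N → ℂ) : Prop :=
  ψ ≠ 0 ∧ A *ᵥ ψ = E • ψ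

/-- The mirror expectation value `⟨ψ|M|ψ⟩ / ⟨ψ|ψ⟩`. -/
noncomputable def mirrorExpectation {N : ℕ} (M : Matrix (Fin N) (Fin N) ℂ) (ψ : Fin N → ℂ) : ℂ :=
  (star ψ ⬝ᵥ (M *ᵥ ψ)) / (star ψ ⬝ᵥ ψ)

/-- The mirror-adjoint parity of a state: the sign of its mirror expectation value, which is real
because `M` is Hermitian. -/
noncomputable def parity {N : ℕ} (M : Matrix (Fin N) (Fin N) ℂ) (ψ : Fin N → ℂ) : SignType :=
  SignType.sign (mirrorExpectation M ψ).re

/-- Algebraic multiplicity of `E` as an eigenvalue of `A`. -/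
noncomputable def algMult {N : ℕ} (A : Matrix (Fin N) (Fin N) ℂ) (E : ℂ) : ℕ :=
  A.charpoly.rootMultiplicity E

/-- Geometric multiplicity of `E` as an eigenvalue of `A`. -/
noncomputable def geomMult {N : ℕ} (A : Matrix (Fin N) (Fin N) ℂ) (E : ℂ) : ℕ :=
  Module.finrank ℂ (Module.End.eigenspace (Matrix.toLin' A) E)

/-- The eigenvalue `E` of `A` is non-defective. -/
def NonDefective {N : ℕ} (A : Matrix (Fin N) (Fin N) ℂ) (E : ℂ) : Prop :=
  geomMult A E = algMult A E

/-- `A` has an exceptional point of order 2 at the eigenvalue `E`: a doubly degenerate eigenvalue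
with a single Jordan block. -/
def IsEP2 {N : ℕ} (A : Matrix (Fin N) (Fin N) ℂ) (E : ℂ) : Prop :=
  algMult A E = 2 ∧ geomMult A E = 1

/-- The curve `γ`, defined on the nondegenerate interval `I`, is an order-2 exceptional line on the
mirror plane, with real energy `e t` at the point `γ t`. Lines that close up are allowed. -/
structure IsExceptionalLine {N : ℕ} (n : Momentum) (Λ : AddSubgroup Momentum)
    (H : Momentum → Matrix (Fin N) (Fin N) ℂ) (I : Set ℝ) (γ : ℝ → Momentum) (e : ℝ → ℝ) :
    Prop where
  ordConnected : I.OrdConnected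
  nontrivial : I.Nontrivial
  continuousOn_curve : ContinuousOn γ I
  locally_injective : ∀ t ∈ I, ∃ U ∈ 𝓝 t, Set.InjOn γ (I ∩ U)
  continuousOn_energy : ContinuousOn e I
  mem_mirrorPlane : ∀ t ∈ I, γ t ∈ mirrorPlane n Λ
  isEP2 : ∀ t ∈ I, IsEP2 (H (γ t)) (e t : ℂ)

/-- `E` is a band on the region `R` that is in the exact phase: a continuous choice of real,
non-degenerate eigenvalues. -/
structure IsExactBand {N : ℕ} (H : Momentum → Matrix (Fin N) (Fin N) ℂ)
    (R : Set Momentum) (E : Momentum → ℝ) : Prop where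
  continuousOn : ContinuousOn E R
  simple : ∀ k ∈ R, algMult (H k) (E k : ℂ) = 1

/-- The band `E` has mirror-adjoint parity `s` on all of `R`. -/
def BandHasParity {N : ℕ} (M : Matrix (Fin N) (Fin N) ℂ)
    (H : Momentum → Matrix (Fin N) (Fin N) ℂ) (R : Set Momentum) (E : Momentum → ℝ)
    (s : SignType) : Prop :=
  ∀ k ∈ R, ∀ ψ, IsEigenstate (H k) (E k : ℂ) ψ → parity M ψ = s

/-- `R` is a region of the mirror plane where two distinct bands `E₁`, `E₂` are in the exact
phase. -/
structure IsExactBandPair {N : ℕ} (n : Momentum) (Λ : AddSubgroup Momentum)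
    (H : Momentum → Matrix (Fin N) (Fin N) ℂ) (R : Set Momentum) (E₁ E₂ : Momentum → ℝ) :
    Prop where
  subset_mirrorPlane : R ⊆ mirrorPlane n Λ
  exact_fst : IsExactBand H R E₁
  exact_snd : IsExactBand H R E₂
  ne : ∀ k ∈ R, E₁ k ≠ E₂ k

/-- The point `k₀` is adjacent to `R`, and the bands `E₁`, `E₂` on `R` both reach the energy `E₀`
there. -/
structure MeetAt (R : Set Momentum) (E₁ E₂ : Momentum → ℝ) (k₀ : Momentum) (E₀ : ℝ) : Prop where
  mem_closure : k₀ ∈ closure R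
  tendsto_fst : Filter.Tendsto E₁ (𝓝[R] k₀) (𝓝 E₀)
  tendsto_snd : Filter.Tendsto E₂ (𝓝[R] k₀) (𝓝 E₀)

end MirrorAdjoint

/-! On the mirror plane the symmetry and periodicity reduce to `M * Aᴴ * M = A` for `A = H k`. Hence
the characteristic polynomial `p` is real, and for a real eigenvalue `E` with eigenvector `ψ` the
row `ψ†M` is a left eigenvector.

If `E` is geometrically simple, then `adj (E - A) = c ψ ψ†M`. Applying it to `ψ†M` gives `p'(E) = c
⟨ψ|M|ψ⟩`; multiplying by `M` and taking the trace gives `T = tr (adj (E - A) M) = c ⟨ψ|ψ⟩`. So `T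
⟨ψ|M|ψ⟩ = p'(E) ⟨ψ|ψ⟩` (`adjugateTrace_mul_star_dotProduct`): the parity is the sign of `p'(E)` up
to the sign of `T`.

The point is that `T` is real, jointly continuous in momentum and energy, and nonzero even at an
exceptional point (`adjugateTrace_re_ne_zero`), so its sign is locally constant there. So is the
sign of `p''`, the root being exactly double. Two nearby real zeros of `p` then have slopes of
opposite signs, hence opposite parities (`exists_opposite_parity`). Along a simple band `T p'` never
vanishes, so the parity is constant on a connected region. -/

namespace MirrorAdjoint

/-! ### Adjugates of singular matrices -/

/-- A square matrix with one-dimensional kernel has a nonzero adjugate. -/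
theorem adjugate_ne_zero_of_ker {ι K : Type*} [Fintype ι] [DecidableEq ι] [Field K]
    {B : Matrix ι ι K} {ψ : ι → K} (hψ : ψ ≠ 0) (hBψ : B *ᵥ ψ = 0)
    (hker : ∀ v, B *ᵥ v = 0 → ∃ a : K, v = a • ψ) : B.adjugate ≠ 0 := by
  intro hadj
  obtain ⟨i, hi⟩ := Function.ne_iff.1 hψ
  have hns : ¬ Function.Surjective B.mulVec := fun hs => by
    have hinj : Function.Injective B.mulVecLin :=
      (LinearMap.injective_iff_surjective (f := B.mulVecLin)).2 hs
    exact hψ (hinj (by simpa using hBψ))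
  obtain ⟨w, hw⟩ := not_forall.1 hns
  -- Here `ψ i ≠ 0` and `w` lies outside the range of `B`. A kernel vector `v` of the modified
  -- matrix has `v i = 0`, or `w` would be in the range; so `v` lies in the kernel of `B`, is a
  -- multiple of `ψ`, and vanishes. By Cramer's rule this determinant is an entry of `adj B` applied
  -- to `w`.
  have hdet : (B.updateCol i w).det ≠ 0 := by
    intro h0
    obtain ⟨v, hv0, hv⟩ := Matrix.exists_mulVec_eq_zero_iff.2 h0
    have hsplit : B *ᵥ (Function.update v i 0) + v i • w = 0 := by
      rw [← hv]
      ext j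
      simp only [Matrix.mulVec, dotProduct, Pi.add_apply, Pi.smul_apply, smul_eq_mul,
        Matrix.updateCol_apply]
      rw [← Finset.add_sum_erase _ _ (Finset.mem_univ i),
        ← Finset.add_sum_erase _ _ (Finset.mem_univ i)]
      rw [Finset.sum_congr rfl (g := fun x => B j x * v x), Finset.sum_congr rfl
        (g := fun x => B j x * v x)
        (f := fun x => (if x = i then w j else B j x) * v x)]
      · simp; ring
      · intro x hx; simp [(Finset.mem_erase.1 hx).1]
      · intro x hx; simp [(Finset.mem_erase.1 hx).1]
    have hvi : v i = 0 := by
      by_contra hvi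
      refine hw ⟨(-(v i)⁻¹) • Function.update v i 0, ?_⟩
      rw [Matrix.mulVec_smul, eq_neg_of_add_eq_zero_left hsplit, smul_neg, neg_smul, neg_neg,
        smul_smul, inv_mul_cancel₀ hvi, one_smul]
    have hup : Function.update v i 0 = v := by rw [← hvi, Function.update_eq_self]
    rw [hup, hvi, zero_smul, add_zero] at hsplit
    obtain ⟨a, rfl⟩ := hker v hsplit
    rw [Pi.smul_apply, smul_eq_mul] at hvi
    rcases mul_eq_zero.1 hvi with ha | ha
    · exact hv0 (by rw [ha, zero_smul])
    · exact hi ha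
  apply hdet
  rw [← Matrix.cramer_apply, Matrix.cramer_eq_adjugate_mulVec, hadj, Matrix.zero_mulVec,
    Pi.zero_apply]

/-- A left eigenvector of `A` is a left eigenvector of the adjugate of `E - A`, with the derivative
of the characteristic polynomial as eigenvalue. -/
theorem vecMul_adjugate_of_vecMul_eq_smul {ι K : Type*} [Fintype ι] [DecidableEq ι] [Field K]
    {A : Matrix ι ι K} {E : K} {φ : ι → K} (hφ : φ ≠ 0) (h : φ ᵥ* A = E • φ) :
    φ ᵥ* (Matrix.scalar ι E - A).adjugate = A.charpoly.derivative.eval E • φ := by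
  have hroot : A.charpoly.IsRoot E := by
    rw [Polynomial.IsRoot, Matrix.eval_charpoly, ← Matrix.exists_vecMul_eq_zero_iff]
    refine ⟨φ, hφ, ?_⟩
    rw [Matrix.vecMul_sub, h, Matrix.scalar_apply, ← Matrix.smul_one_eq_diagonal,
      Matrix.vecMul_smul, Matrix.vecMul_one, sub_self]
  obtain ⟨g, hg⟩ := Polynomial.dvd_iff_isRoot.2 hroot
  have hleft : (Polynomial.C ∘ φ) ᵥ* A.charmatrix
      = (Polynomial.X - Polynomial.C E) • (Polynomial.C ∘ φ) := by
    rw [Matrix.charmatrix, Matrix.vecMul_sub, Matrix.scalar_apply, ← Matrix.smul_one_eq_diagonal,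
      Matrix.vecMul_smul, Matrix.vecMul_one, sub_smul]
    congr 1
    ext1 j
    have := congrArg Polynomial.C (congrFun h j)
    simpa [Matrix.vecMul, dotProduct] using this
  have hadj : (Polynomial.C ∘ φ) ᵥ* A.charmatrix.adjugate = g • (Polynomial.C ∘ φ) := by
    -- The factor `X - E` can be cancelled over the polynomial ring, whereas it is zero after
    -- evaluation at `E`.
    have h1 : (Polynomial.X - Polynomial.C E) • ((Polynomial.C ∘ φ) ᵥ* A.charmatrix.adjugate)
        = (Polynomial.X - Polynomial.C E) • (g • (Polynomial.C ∘ φ)) := by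
      rw [← Matrix.smul_vecMul, ← hleft, Matrix.vecMul_vecMul, Matrix.mul_adjugate,
        Matrix.vecMul_smul, Matrix.vecMul_one, smul_smul, ← hg, Matrix.charpoly]
    ext1 j
    exact mul_left_cancel₀ (Polynomial.X_sub_C_ne_zero E) (congrFun h1 j)
  have hderiv : A.charpoly.derivative.eval E = g.eval E := by
    rw [hg]; simp
  have heval : (Polynomial.evalRingHom E).mapMatrix A.charmatrix = Matrix.scalar ι E - A := by
    ext a b
    by_cases hab : a = b
    · subst hab; simp
    · simp [hab]
  rw [hderiv, ← heval, ← RingHom.map_adjugate]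
  ext j
  have := congrArg (Polynomial.eval E) (congrFun hadj j)
  simpa [Matrix.vecMul, dotProduct, Polynomial.eval_finsetSum] using this

end MirrorAdjoint

namespace MirrorAdjoint

/-! ### Continuity of the characteristic polynomial -/

/-- Each coefficient is a universal polynomial in the matrix entries. -/
theorem continuous_charpoly_coeff {N : ℕ} {X : Type*} [TopologicalSpace X]
    {A : X → Matrix (Fin N) (Fin N) ℂ} (hA : Continuous A) (i : ℕ) :
    Continuous fun x => (A x).charpoly.coeff i := by
  have h : ∀ x, (A x).charpoly.coeff i = MvPolynomial.eval (fun q : Fin N × Fin N => A x q.1 q.2)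
      ((Matrix.charpoly.univ ℂ (Fin N)).coeff i) := fun x =>
    (Matrix.charpoly.univ_coeff_eval₂Hom (Fin N) (RingHom.id ℂ)
      (fun q : Fin N × Fin N => A x q.1 q.2) i).symm
  simp_rw [h]
  exact (MvPolynomial.continuous_eval _).comp
    (continuous_pi fun q => hA.matrix_elem q.1 q.2)

theorem continuous_eval_of_coeff {X : Type*} [TopologicalSpace X] {p : X → Polynomial ℂ} {d : ℕ}
    (hd : ∀ x, (p x).natDegree < d) (hp : ∀ i, Continuous fun x => (p x).coeff i)
    {z : X → ℂ} (hz : Continuous z) : Continuous fun x => (p x).eval (z x) := by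
  have h : ∀ x, (p x).eval (z x) = ∑ i ∈ Finset.range d, (p x).coeff i * z x ^ i := fun x =>
    Polynomial.eval_eq_sum_range' (hd x) _
  simp_rw [h]
  exact continuous_finsetSum _ fun i _ => (hp i).mul (hz.pow i)

theorem continuous_eval_iterate_derivative_charpoly {N : ℕ} {X : Type*} [TopologicalSpace X]
    {A : X → Matrix (Fin N) (Fin N) ℂ} (hA : Continuous A) (j : ℕ) {z : X → ℂ}
    (hz : Continuous z) :
    Continuous fun x => (Polynomial.derivative^[j] (A x).charpoly).eval (z x) := by
  refine continuous_eval_of_coeff (d := N + 1) (fun x => ?_) (fun i => ?_) hz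
  · have h1 := Polynomial.natDegree_iterate_derivative (A x).charpoly j
    have h2 := (A x).charpoly_natDegree_eq_dim
    rw [Fintype.card_fin] at h2
    omega
  · simp_rw [Polynomial.coeff_iterate_derivative]
    exact (continuous_charpoly_coeff hA _).const_smul _

/-! ### Multiplicities -/

theorem geomMult_le_algMult {N : ℕ} (A : Matrix (Fin N) (Fin N) ℂ) (E : ℂ) :
    geomMult A E ≤ algMult A E := by
  rw [geomMult, algMult, ← Matrix.charpoly_toLin']
  exact LinearMap.finrank_eigenspace_le _ _

theorem isEigenstate_iff {N : ℕ} {A : Matrix (Fin N) (Fin N) ℂ} {E : ℂ} {ψ : Fin N → ℂ} :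
    IsEigenstate A E ψ ↔ ψ ≠ 0 ∧ (Matrix.scalar (Fin N) E - A) *ᵥ ψ = 0 := by
  rw [IsEigenstate, Matrix.sub_mulVec, Matrix.scalar_apply, ← Matrix.smul_one_eq_diagonal,
    Matrix.smul_mulVec, Matrix.one_mulVec, sub_eq_zero, eq_comm (a := E • ψ)]

theorem exists_isEigenstate_iff {N : ℕ} {A : Matrix (Fin N) (Fin N) ℂ} {E : ℂ} :
    (∃ ψ, IsEigenstate A E ψ) ↔ A.charpoly.IsRoot E := by
  simp_rw [isEigenstate_iff]
  rw [Polynomial.IsRoot, Matrix.eval_charpoly]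
  exact Matrix.exists_mulVec_eq_zero_iff

theorem exists_isEigenstate {N : ℕ} {A : Matrix (Fin N) (Fin N) ℂ} {E : ℂ}
    (h : algMult A E ≠ 0) : ∃ ψ, IsEigenstate A E ψ :=
  exists_isEigenstate_iff.2 ((Polynomial.rootMultiplicity_pos A.charpoly_monic.ne_zero).1
    (Nat.pos_of_ne_zero h))

theorem IsEigenstate.geomMult_pos {N : ℕ} {A : Matrix (Fin N) (Fin N) ℂ} {E : ℂ}
    {ψ : Fin N → ℂ} (h : IsEigenstate A E ψ) : 0 < geomMult A E := by
  refine Module.finrank_pos_iff_exists_ne_zero.2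
    ⟨⟨ψ, Module.End.mem_eigenspace_iff.2 ?_⟩, fun h0 => h.1 (congrArg Subtype.val h0)⟩
  rw [Matrix.toLin'_apply, h.2]

theorem geomMult_eq_one_of_algMult {N : ℕ} {A : Matrix (Fin N) (Fin N) ℂ} {E : ℂ}
    (h : algMult A E = 1) : geomMult A E = 1 := by
  obtain ⟨ψ, hψ⟩ := exists_isEigenstate (h ▸ one_ne_zero)
  have := geomMult_le_algMult A E
  have := hψ.geomMult_pos
  omega

theorem exists_smul_of_geomMult_eq_one {N : ℕ} {A : Matrix (Fin N) (Fin N) ℂ} {E : ℂ}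
    {ψ : Fin N → ℂ} (hg : geomMult A E = 1) (hψ : IsEigenstate A E ψ) {v : Fin N → ℂ}
    (hv : (Matrix.scalar (Fin N) E - A) *ᵥ v = 0) : ∃ a : ℂ, v = a • ψ := by
  have hv' : A *ᵥ v = E • v := by
    by_cases h0 : v = 0
    · simp [h0]
    · exact (isEigenstate_iff.2 ⟨h0, hv⟩).2
  have hm : ∀ u, A *ᵥ u = E • u → u ∈ Module.End.eigenspace (Matrix.toLin' A) E := fun u hu =>
    Module.End.mem_eigenspace_iff.2 (by rw [Matrix.toLin'_apply, hu])
  obtain ⟨a, ha⟩ := exists_smul_eq_of_finrank_eq_one hg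
    (x := ⟨ψ, hm ψ hψ.2⟩) (fun h0 => hψ.1 (congrArg Subtype.val h0)) ⟨v, hm v hv'⟩
  exact ⟨a, (congrArg Subtype.val ha).symm⟩

theorem algMult_eq_one_iff {N : ℕ} {A : Matrix (Fin N) (Fin N) ℂ} {E : ℂ} :
    algMult A E = 1 ↔ A.charpoly.IsRoot E ∧ A.charpoly.derivative.eval E ≠ 0 := by
  have h0 := A.charpoly_monic.ne_zero
  have h1 := Polynomial.one_lt_rootMultiplicity_iff_isRoot h0 (t := E)
  have h2 := Polynomial.rootMultiplicity_pos h0 (x := E)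
  unfold algMult
  constructor
  · intro h
    refine ⟨h2.1 (by omega), fun h' => ?_⟩
    have := h1.2 ⟨h2.1 (by omega), h'⟩
    omega
  · rintro ⟨hr, hd⟩
    have := h2.2 hr
    have : ¬ 1 < A.charpoly.rootMultiplicity E := fun h => hd (h1.1 h).2
    omega

theorem eval_derivative_derivative_charpoly_ne_zero {N : ℕ} {A : Matrix (Fin N) (Fin N) ℂ} {E : ℂ}
    (h : algMult A E = 2) : A.charpoly.derivative.derivative.eval E ≠ 0 := by
  have h0 := A.charpoly_monic.ne_zero
  intro h2
  have h1 := (Polynomial.one_lt_rootMultiplicity_iff_isRoot h0 (t := E)).1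
    (by rw [algMult] at h; omega)
  have : 2 < A.charpoly.rootMultiplicity E := by
    refine Polynomial.lt_rootMultiplicity_of_isRoot_iterate_derivative h0 (fun m hm => ?_)
    interval_cases m
    · exact h1.1
    · exact h1.2
    · exact h2
  rw [algMult] at h
  omega

end MirrorAdjoint

namespace MirrorAdjoint

/-! ### Matrices that are self-adjoint for the indefinite form of `M` -/

section PseudoHermitian

variable {N : ℕ} {M A : Matrix (Fin N) (Fin N) ℂ}

theorem mul_eq_conjTranspose_mul (hMM : M * M = 1) (hA : M * Aᴴ * M = A) : M * A = Aᴴ * M := by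
  rw [← hA, ← mul_assoc, ← mul_assoc, hMM, one_mul, hA]

theorem mul_eq_mul_conjTranspose (hMM : M * M = 1) (hA : M * Aᴴ * M = A) : A * M = M * Aᴴ := by
  rw [← hA, mul_assoc, hMM, mul_one, hA]

theorem conjTranspose_eq_mul_mul (hMM : M * M = 1) (hA : M * Aᴴ * M = A) : M * A * M = Aᴴ := by
  rw [mul_eq_conjTranspose_mul hMM hA, mul_assoc, hMM, mul_one]

theorem scalar_sub_pseudoHermitian (hMM : M * M = 1) (hA : M * Aᴴ * M = A) (E : ℝ) :
    M * (Matrix.scalar (Fin N) (E : ℂ) - A)ᴴ * M = Matrix.scalar (Fin N) (E : ℂ) - A := by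
  have h : (Matrix.scalar (Fin N) (E : ℂ))ᴴ = Matrix.scalar (Fin N) (E : ℂ) := by
    simp [Matrix.diagonal_conjTranspose, Pi.star_def]
  rw [Matrix.conjTranspose_sub, h, mul_sub, sub_mul, hA, Matrix.scalar_apply,
    ← Matrix.smul_one_eq_diagonal, mul_smul_comm, mul_one, smul_mul_assoc, hMM]

/-- Conjugating the coefficients gives the characteristic polynomial of `Aᴴ`, which is similar to
`A` through `M`. -/
theorem map_conj_charpoly (hMM : M * M = 1) (hA : M * Aᴴ * M = A) :
    A.charpoly.map (starRingEnd ℂ) = A.charpoly := by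
  have h : A.charpoly.map (starRingEnd ℂ) = Aᴴ.charpoly := by
    rw [← Matrix.charpoly_map, ← Matrix.charpoly_transpose]
    rfl
  rw [h, ← conjTranspose_eq_mul_mul hMM hA, Matrix.charpoly_mul_comm, ← mul_assoc, hMM, one_mul]

theorem eval_iterate_derivative_charpoly_im (hMM : M * M = 1) (hA : M * Aᴴ * M = A) (j : ℕ)
    (E : ℝ) : ((Polynomial.derivative^[j] A.charpoly).eval (E : ℂ)).im = 0 := by
  rw [← Complex.conj_eq_iff_im, ← Polynomial.eval_map_apply, ← Polynomial.iterate_derivative_map,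
    map_conj_charpoly hMM hA, Complex.conj_ofReal]

/-- The trace of `adj (E - A) M`, whose sign relates parities to slopes of the characteristic
polynomial. -/
noncomputable def adjugateTrace (M A : Matrix (Fin N) (Fin N) ℂ) (E : ℂ) : ℂ :=
  ((Matrix.scalar (Fin N) E - A).adjugate * M).trace

theorem continuous_adjugateTrace {X : Type*} [TopologicalSpace X]
    {B : X → Matrix (Fin N) (Fin N) ℂ} (hB : Continuous B) {z : X → ℂ} (hz : Continuous z) :
    Continuous fun x => adjugateTrace M (B x) (z x) := by
  have h : Continuous fun x => Matrix.scalar (Fin N) (z x) := by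
    simp_rw [Matrix.scalar_apply]
    exact (continuous_pi fun _ => hz).matrix_diagonal
  exact ((h.sub hB).matrix_adjugate.matrix_mul continuous_const).matrix_trace

/-- The matrix `adj (E - A) M` is itself Hermitian: `adj M = det M • M` and `(det M)² = 1`, so the
adjugate inherits the symmetry of `E - A`. -/
theorem adjugateTrace_im (hM : M.IsHermitian) (hMM : M * M = 1) (hA : M * Aᴴ * M = A) (E : ℝ) :
    (adjugateTrace M A (E : ℂ)).im = 0 := by
  have hdet : M.det * M.det = 1 := by rw [← Matrix.det_mul, hMM, Matrix.det_one]
  have hadj : M.adjugate = M.det • M := by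
    rw [← mul_one M.adjugate, ← hMM, ← mul_assoc, Matrix.adjugate_mul, smul_mul_assoc, one_mul]
  rw [← Complex.conj_eq_iff_im, starRingEnd_apply, adjugateTrace, ← Matrix.trace_conjTranspose,
    Matrix.conjTranspose_mul, hM.eq, Matrix.adjugate_conjTranspose,
    ← conjTranspose_eq_mul_mul hMM (scalar_sub_pseudoHermitian hMM hA E),
    Matrix.adjugate_mul_distrib, Matrix.adjugate_mul_distrib, hadj]
  congr 1
  simp only [smul_mul_assoc, mul_smul_comm, smul_smul, hdet, one_smul]
  rw [← mul_assoc, ← mul_assoc, hMM, one_mul]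

theorem star_vecMul_of_isEigenstate (hMM : M * M = 1) (hA : M * Aᴴ * M = A) {E : ℝ}
    {ψ : Fin N → ℂ} (hψ : IsEigenstate A (E : ℂ) ψ) :
    (star ψ ᵥ* M) ᵥ* A = (E : ℂ) • (star ψ ᵥ* M) := by
  rw [Matrix.vecMul_vecMul, mul_eq_conjTranspose_mul hMM hA, ← Matrix.vecMul_vecMul,
    ← Matrix.star_mulVec, hψ.2, star_smul, Matrix.smul_vecMul]
  simp

/-- Since `E - A` is singular, the columns of its adjugate lie in the kernel, spanned by `ψ`, and
its rows in the left kernel, which the symmetry identifies with the span of `ψ†M`. -/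
theorem adjugate_eq_smul_vecMulVec (hM : M.IsHermitian) (hMM : M * M = 1) (hA : M * Aᴴ * M = A)
    {E : ℝ} {ψ : Fin N → ℂ} (hg : geomMult A (E : ℂ) = 1) (hψ : IsEigenstate A (E : ℂ) ψ) :
    ∃ c : ℂ, (Matrix.scalar (Fin N) (E : ℂ) - A).adjugate
      = c • Matrix.vecMulVec ψ (star ψ ᵥ* M) := by
  set B := Matrix.scalar (Fin N) (E : ℂ) - A with hB
  have hψB := isEigenstate_iff.1 hψ
  have hdet : B.det = 0 := Matrix.exists_mulVec_eq_zero_iff.1 ⟨ψ, hψB⟩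
  have hcol : ∀ j, ∃ a : ℂ, B.adjugate.col j = a • ψ := fun j => by
    refine exists_smul_of_geomMult_eq_one hg hψ ?_
    rw [← hB, ← Matrix.mulVec_single_one, Matrix.mulVec_mulVec, Matrix.mul_adjugate, hdet,
      zero_smul, Matrix.zero_mulVec]
  choose w hw using hcol
  have hadj : B.adjugate = Matrix.vecMulVec ψ w := by
    ext i j
    rw [Matrix.vecMulVec_apply, mul_comm]
    exact congrFun (hw j) i
  have hwB : w ᵥ* B = 0 := by
    have h := B.adjugate_mul
    rw [hdet, zero_smul, hadj, Matrix.vecMulVec_mul] at h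
    obtain ⟨i, hi⟩ := Function.ne_iff.1 hψ.1
    ext j
    have := congrFun (congrFun h i) j
    rw [Matrix.vecMulVec_apply] at this
    exact (mul_eq_zero.1 this).resolve_left hi
  have hker : B *ᵥ (M *ᵥ star w) = 0 := by
    rw [Matrix.mulVec_mulVec, mul_eq_mul_conjTranspose hMM (scalar_sub_pseudoHermitian hMM hA E),
      ← Matrix.mulVec_mulVec, ← Matrix.star_vecMul, hwB, star_zero, Matrix.mulVec_zero]
  obtain ⟨d, hd⟩ := exists_smul_of_geomMult_eq_one hg hψ hker
  have hw' : w = star d • (star ψ ᵥ* M) := by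
    apply star_injective
    rw [star_smul, star_star, Matrix.star_vecMul, hM.eq, star_star, ← Matrix.mulVec_smul, ← hd,
      Matrix.mulVec_mulVec, hMM, Matrix.one_mulVec]
  exact ⟨star d, by rw [hadj, hw', Matrix.vecMulVec_smul]⟩

open scoped ComplexOrder in
theorem exists_star_dotProduct_self {ψ : Fin N → ℂ} (hψ : ψ ≠ 0) :
    ∃ r : ℝ, 0 < r ∧ star ψ ⬝ᵥ ψ = (r : ℂ) := by
  have h := Complex.pos_iff.1 (Matrix.dotProduct_star_self_pos_iff.2 hψ)
  exact ⟨_, h.1,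
    Complex.ext (Complex.ofReal_re _).symm (h.2.symm.trans (Complex.ofReal_im _).symm)⟩

theorem parity_eq_sign {ψ : Fin N → ℂ} (hψ : ψ ≠ 0) :
    parity M ψ = SignType.sign (star ψ ⬝ᵥ (M *ᵥ ψ)).re := by
  obtain ⟨r, hr, h⟩ := exists_star_dotProduct_self hψ
  rw [parity, mirrorExpectation, h, Complex.div_ofReal_re, div_eq_mul_inv, sign_mul,
    sign_pos (inv_pos.2 hr), mul_one]

theorem adjugateTrace_mul_star_dotProduct (hM : M.IsHermitian) (hMM : M * M = 1)
    (hA : M * Aᴴ * M = A) {E : ℝ} {ψ : Fin N → ℂ} (hg : geomMult A (E : ℂ) = 1)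
    (hψ : IsEigenstate A (E : ℂ) ψ) :
    adjugateTrace M A (E : ℂ) * (star ψ ⬝ᵥ (M *ᵥ ψ))
      = A.charpoly.derivative.eval (E : ℂ) * (star ψ ⬝ᵥ ψ) := by
  obtain ⟨c, hc⟩ := adjugate_eq_smul_vecMulVec hM hMM hA hg hψ
  have hφM : (star ψ ᵥ* M) ᵥ* M = star ψ := by
    rw [Matrix.vecMul_vecMul, hMM, Matrix.vecMul_one]
  have hφ : star ψ ᵥ* M ≠ 0 := fun h => hψ.1 (by
    rw [h, Matrix.zero_vecMul] at hφM
    exact star_eq_zero.1 hφM.symm)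
  have htr : adjugateTrace M A (E : ℂ) = c * (star ψ ⬝ᵥ ψ) := by
    rw [adjugateTrace, hc, smul_mul_assoc, Matrix.vecMulVec_mul, hφM, Matrix.trace_smul,
      Matrix.trace_vecMulVec, dotProduct_comm, smul_eq_mul]
  have hleft := vecMul_adjugate_of_vecMul_eq_smul hφ (star_vecMul_of_isEigenstate hMM hA hψ)
  rw [hc, Matrix.vecMul_smul, Matrix.vecMul_vecMulVec, smul_smul] at hleft
  have hder := smul_left_injective ℂ hφ hleft
  rw [← Matrix.dotProduct_mulVec] at hder
  rw [htr, ← hder]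
  ring

/-- The parity of a geometrically simple real eigenvalue is determined by the sign of
`adjugateTrace` and the slope of the characteristic polynomial. -/
theorem sign_adjugateTrace_mul_parity (hM : M.IsHermitian) (hMM : M * M = 1)
    (hA : M * Aᴴ * M = A) {E : ℝ} {ψ : Fin N → ℂ} (hg : geomMult A (E : ℂ) = 1)
    (hψ : IsEigenstate A (E : ℂ) ψ) :
    SignType.sign (adjugateTrace M A (E : ℂ)).re * parity M ψ
      = SignType.sign (A.charpoly.derivative.eval (E : ℂ)).re := by
  have h := congrArg Complex.re (adjugateTrace_mul_star_dotProduct hM hMM hA hg hψ)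
  obtain ⟨r, hr, hr'⟩ := exists_star_dotProduct_self hψ.1
  rw [hr', Complex.re_mul_ofReal, Complex.mul_re, adjugateTrace_im hM hMM hA, zero_mul,
    sub_zero] at h
  rw [parity_eq_sign hψ.1, ← sign_mul, h, sign_mul, sign_pos hr, mul_one]

/-- The trace is `c ⟨ψ|ψ⟩`, and `c ≠ 0` because a one-dimensional kernel leaves the adjugate
nonzero. Only geometric simplicity enters, so exceptional points are covered. -/
theorem adjugateTrace_re_ne_zero (hM : M.IsHermitian) (hMM : M * M = 1)
    (hA : M * Aᴴ * M = A) {E : ℝ} (hg : geomMult A (E : ℂ) = 1) :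
    (adjugateTrace M A (E : ℂ)).re ≠ 0 := by
  obtain ⟨ψ, hψ⟩ := exists_isEigenstate
    (Nat.pos_iff_ne_zero.1 (lt_of_lt_of_le (hg ▸ Nat.one_pos) (geomMult_le_algMult A (E : ℂ))))
  have hψB := isEigenstate_iff.1 hψ
  have hne := adjugate_ne_zero_of_ker hψ.1 hψB.2 fun v hv =>
    exists_smul_of_geomMult_eq_one hg hψ hv
  obtain ⟨c, hc⟩ := adjugate_eq_smul_vecMulVec hM hMM hA hg hψ
  obtain ⟨r, hr, hr'⟩ := exists_star_dotProduct_self hψ.1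
  have htr : adjugateTrace M A (E : ℂ) = c * r := by
    rw [adjugateTrace, hc, smul_mul_assoc, Matrix.vecMulVec_mul, Matrix.vecMul_vecMul, hMM,
      Matrix.vecMul_one, Matrix.trace_smul, Matrix.trace_vecMulVec, dotProduct_comm, hr',
      smul_eq_mul]
  intro h0
  have h1 : adjugateTrace M A (E : ℂ) = 0 := Complex.ext h0 (adjugateTrace_im hM hMM hA E)
  rw [htr] at h1
  rcases mul_eq_zero.1 h1 with h2 | h2
  · exact hne (by rw [hc, h2, zero_smul])
  · exact hr.ne' (by exact_mod_cast h2)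

end PseudoHermitian

end MirrorAdjoint

namespace MirrorAdjoint

/-! ### Parities near an exceptional point -/

theorem sign_eq_sign_of_mul_pos {x y : ℝ} (h : 0 < x * y) :
    SignType.sign x = SignType.sign y := by
  have h1 := sign_pos h
  rw [sign_mul] at h1
  generalize SignType.sign x = a at h1 ⊢
  generalize SignType.sign y = b at h1 ⊢
  revert a b
  decide

/-- At two consecutive real zeros, between which the second derivative keeps its sign, a polynomial
has slopes of opposite signs. -/
theorem slopes_of_second_derivative {p : Polynomial ℂ} {a b s : ℝ} (hab : a < b)
    (ha : p.eval (a : ℂ) = 0) (hb : p.eval (b : ℂ) = 0)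
    (hs : ∀ x ∈ Set.Icc a b, 0 < (p.derivative.derivative.eval (x : ℂ)).re * s) :
    (p.derivative.eval (a : ℂ)).re * s < 0 ∧ 0 < (p.derivative.eval (b : ℂ)).re * s := by
  have hd : ∀ (q : Polynomial ℂ) (x : ℝ), HasDerivAt (fun y : ℝ => (q.eval (y : ℂ)).re)
      (q.derivative.eval (x : ℂ)).re x := fun q x => (q.hasDerivAt (x : ℂ)).real_of_complex
  -- Rolle gives a critical point `c` between the zeros; strict monotonicity of `p' * s` then fixes
  -- the signs on either side.
  obtain ⟨c, hc, hc0⟩ := exists_hasDerivAt_eq_zero hab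
    (fun x _ => (hd p x).continuousAt.continuousWithinAt) (by simp [ha, hb])
    (fun x _ => hd p x)
  have hd2 : ∀ x : ℝ, HasDerivAt (fun y : ℝ => (p.derivative.eval (y : ℂ)).re * s)
      ((p.derivative.derivative.eval (x : ℂ)).re * s) x := fun x => (hd _ x).mul_const s
  have hmono : StrictMonoOn (fun y : ℝ => (p.derivative.eval (y : ℂ)).re * s) (Set.Icc a b) := by
    refine strictMonoOn_of_deriv_pos (convex_Icc a b)
      (fun x _ => (hd2 x).continuousAt.continuousWithinAt) fun x hx => ?_
    rw [(hd2 x).deriv]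
    exact hs x (interior_subset hx)
  have hcI := Set.Ioo_subset_Icc_self hc
  have h1 := hmono (Set.left_mem_Icc.2 hab.le) hcI hc.1
  have h2 := hmono hcI (Set.right_mem_Icc.2 hab.le) hc.2
  simp only [hc0, zero_mul] at h1 h2
  exact ⟨h1, h2⟩

theorem symm_of_mem_mirrorPlane {N : ℕ} {n : Momentum} {Λ : AddSubgroup Momentum}
    {M : Matrix (Fin N) (Fin N) ℂ} (hMM : M * M = 1) {H : Momentum → Matrix (Fin N) (Fin N) ℂ}
    (hper : ∀ k, ∀ g ∈ Λ, H (k + g) = H k) (hsym : MirrorAdjointSymmetric n M H) {k : Momentum}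
    (hk : k ∈ mirrorPlane n Λ) : M * (H k)ᴴ * M = H k := by
  have h := hsym k
  rwa [Matrix.inv_eq_right_inv hMM, ← add_sub_cancel k (mirror n k), hper k _ hk] at h

section

variable {N : ℕ} {M : Matrix (Fin N) (Fin N) ℂ} {H : Momentum → Matrix (Fin N) (Fin N) ℂ}

theorem exists_opposite_parity (hM : M.IsHermitian) (hMM : M * M = 1) (hcont : Continuous H)
    {k₀ : Momentum} {E₀ : ℝ} (hA₀ : M * (H k₀)ᴴ * M = H k₀) (hEP : IsEP2 (H k₀) (E₀ : ℂ)) :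
    ∃ ε > 0, ∀ k, M * (H k)ᴴ * M = H k → dist k k₀ < ε →
      ∀ E₁ E₂ : ℝ, E₁ ≠ E₂ → |E₁ - E₀| < ε → |E₂ - E₀| < ε →
      ∀ ψ₁ ψ₂ : Fin N → ℂ, IsEigenstate (H k) (E₁ : ℂ) ψ₁ → IsEigenstate (H k) (E₂ : ℂ) ψ₂ →
        parity M ψ₁ ≠ 0 ∧ parity M ψ₂ = -parity M ψ₁ := by
  let F : Momentum × ℝ → ℝ := fun x => (adjugateTrace M (H x.1) (x.2 : ℂ)).re
  let S : Momentum × ℝ → ℝ := fun x =>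
    ((Polynomial.derivative^[2] (H x.1).charpoly).eval (x.2 : ℂ)).re
  have hz : Continuous fun x : Momentum × ℝ => (x.2 : ℂ) :=
    Complex.continuous_ofReal.comp continuous_snd
  have hF : Continuous F :=
    Complex.continuous_re.comp (continuous_adjugateTrace (hcont.comp continuous_fst) hz)
  have hS : Continuous S := Complex.continuous_re.comp
    (continuous_eval_iterate_derivative_charpoly (hcont.comp continuous_fst) 2 hz)
  have hF0 : F (k₀, E₀) ≠ 0 := adjugateTrace_re_ne_zero hM hMM hA₀ hEP.2
  have hS0 : S (k₀, E₀) ≠ 0 := fun h => eval_derivative_derivative_charpoly_ne_zero hEP.1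
    (Complex.ext h (eval_iterate_derivative_charpoly_im hMM hA₀ 2 E₀))
  have hev : ∀ᶠ x in 𝓝 (k₀, E₀), 0 < F x * F (k₀, E₀) ∧ 0 < S x * S (k₀, E₀) :=
    ((hF.mul continuous_const).continuousAt.eventually_const_lt (mul_self_pos.2 hF0)).and
      ((hS.mul continuous_const).continuousAt.eventually_const_lt (mul_self_pos.2 hS0))
  obtain ⟨ε, hε, hball⟩ := Metric.eventually_nhds_iff.1 hev
  have hnear : ∀ k : Momentum, dist k k₀ < ε → ∀ E : ℝ, |E - E₀| < ε →
      0 < F (k, E) * F (k₀, E₀) ∧ 0 < S (k, E) * S (k₀, E₀) := fun k hk E hE =>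
    hball (by rw [Prod.dist_eq]; exact max_lt hk (by rwa [Real.dist_eq]))
  have key : ∀ k, M * (H k)ᴴ * M = H k → dist k k₀ < ε →
      ∀ E₁ E₂ : ℝ, E₁ < E₂ → |E₁ - E₀| < ε → |E₂ - E₀| < ε →
      ∀ ψ₁ ψ₂ : Fin N → ℂ, IsEigenstate (H k) (E₁ : ℂ) ψ₁ → IsEigenstate (H k) (E₂ : ℂ) ψ₂ →
        parity M ψ₁ ≠ 0 ∧ parity M ψ₂ = -parity M ψ₁ := by
    intro k hA hk E₁ E₂ h12 h1 h2 ψ₁ ψ₂ hψ₁ hψ₂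
    have hr1 := exists_isEigenstate_iff.1 ⟨ψ₁, hψ₁⟩
    have hr2 := exists_isEigenstate_iff.1 ⟨ψ₂, hψ₂⟩
    -- The energy window is convex, so the sign of `p''` is controlled on the whole segment between
    -- the two energies.
    have hslope := slopes_of_second_derivative (s := S (k₀, E₀)) h12 hr1 hr2 fun x hx =>
      (hnear k hk x (abs_lt.2 ⟨by linarith [(abs_lt.1 h1).1, hx.1],
        by linarith [(abs_lt.1 h2).2, hx.2]⟩)).2
    -- Simplicity is not assumed: it follows from the nonzero slope.
    have hg1 : geomMult (H k) (E₁ : ℂ) = 1 := geomMult_eq_one_of_algMult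
      (algMult_eq_one_iff.2 ⟨hr1, fun h => by simp [h] at hslope⟩)
    have hg2 : geomMult (H k) (E₂ : ℂ) = 1 := geomMult_eq_one_of_algMult
      (algMult_eq_one_iff.2 ⟨hr2, fun h => by simp [h] at hslope⟩)
    have hp1 := sign_adjugateTrace_mul_parity hM hMM hA hg1 hψ₁
    have hp2 := sign_adjugateTrace_mul_parity hM hMM hA hg2 hψ₂
    have hs1 := sign_neg hslope.1
    have hs2 := sign_pos hslope.2
    have hF1 : SignType.sign (adjugateTrace M (H k) (E₁ : ℂ)).re = SignType.sign (F (k₀, E₀)) :=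
      sign_eq_sign_of_mul_pos (hnear k hk E₁ h1).1
    have hF2 : SignType.sign (adjugateTrace M (H k) (E₂ : ℂ)).re = SignType.sign (F (k₀, E₀)) :=
      sign_eq_sign_of_mul_pos (hnear k hk E₂ h2).1
    have ha := sign_ne_zero.2 hF0
    rw [sign_mul, ← hp1, hF1] at hs1
    rw [sign_mul, ← hp2, hF2] at hs2
    generalize parity M ψ₁ = p₁ at *
    generalize parity M ψ₂ = p₂ at *
    generalize SignType.sign (F (k₀, E₀)) = a at *
    generalize SignType.sign (S (k₀, E₀)) = b at *
    -- What remains is a finite check: `a * p₁ * b = -1` and `a * p₂ * b = 1` force `p₂ = -p₁ ≠ 0`.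
    clear * - hs1 hs2 ha
    revert p₁ p₂ a b
    decide
  refine ⟨ε, hε, fun k hA hk E₁ E₂ hne h1 h2 ψ₁ ψ₂ hψ₁ hψ₂ => ?_⟩
  rcases lt_or_gt_of_ne hne with h | h
  · exact key k hA hk E₁ E₂ h h1 h2 ψ₁ ψ₂ hψ₁ hψ₂
  · obtain ⟨hp, hp'⟩ := key k hA hk E₂ E₁ h h2 h1 ψ₂ ψ₁ hψ₂ hψ₁
    rw [hp', neg_neg]
    exact ⟨fun h0 => hp (by rw [← neg_neg (parity M ψ₂), h0]; rfl), rfl⟩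

/-! ### Constancy of the parity of a band -/

/-- The sign of `T` squares to one, so it can be moved across the slope identity. The resulting
formula no longer involves `ψ`, which makes continuity in the momentum available without choosing
eigenvectors. -/
theorem sign_mul_eq_parity (hM : M.IsHermitian) (hMM : M * M = 1) {A : Matrix (Fin N) (Fin N) ℂ}
    (hA : M * Aᴴ * M = A) {E : ℝ} (hE : algMult A (E : ℂ) = 1) {ψ : Fin N → ℂ}
    (hψ : IsEigenstate A (E : ℂ) ψ) :
    parity M ψ = SignType.sign ((adjugateTrace M A (E : ℂ)).re *
      (A.charpoly.derivative.eval (E : ℂ)).re) := by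
  have hg := geomMult_eq_one_of_algMult hE
  have ha := sign_ne_zero.2 (adjugateTrace_re_ne_zero hM hMM hA hg)
  rw [sign_mul, ← sign_adjugateTrace_mul_parity hM hMM hA hg hψ]
  generalize SignType.sign (adjugateTrace M A (E : ℂ)).re = a at *
  generalize parity M ψ = p
  clear * - ha
  revert a p
  decide

theorem IsExactBand.exists_bandHasParity (hM : M.IsHermitian) (hMM : M * M = 1)
    (hcont : Continuous H) {R : Set Momentum} (hR : IsPreconnected R)
    (hA : ∀ k ∈ R, M * (H k)ᴴ * M = H k) {E : Momentum → ℝ} (hE : IsExactBand H R E) :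
    ∃ s : SignType, BandHasParity M H R E s := by
  rcases R.eq_empty_or_nonempty with rfl | ⟨k₁, hk₁⟩
  · exact ⟨1, fun k hk => hk.elim⟩
  let G : Momentum → ℝ := fun k => (adjugateTrace M (H k) (E k : ℂ)).re *
    ((Polynomial.derivative^[1] (H k).charpoly).eval (E k : ℂ)).re
  have hG : ContinuousOn G R := by
    rw [continuousOn_iff_continuous_domRestrict]
    have hH : Continuous fun k : R => H k := hcont.comp continuous_subtype_val
    have hz : Continuous fun k : R => (E k : ℂ) :=
      Complex.continuous_ofReal.comp (continuousOn_iff_continuous_domRestrict.1 hE.continuousOn)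
    exact (Complex.continuous_re.comp (continuous_adjugateTrace hH hz)).mul
      (Complex.continuous_re.comp (continuous_eval_iterate_derivative_charpoly hH 1 hz))
  have hG0 : ∀ k ∈ R, G k ≠ 0 := fun k hk => by
    refine mul_ne_zero (adjugateTrace_re_ne_zero hM hMM (hA k hk)
      (geomMult_eq_one_of_algMult (hE.simple k hk))) fun h => ?_
    exact (algMult_eq_one_iff.1 (hE.simple k hk)).2
      (Complex.ext h (eval_iterate_derivative_charpoly_im hMM (hA k hk) 1 (E k)))
  have hsign : ContinuousOn (fun k => SignType.sign (G k)) R := fun k hk =>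
    (continuousAt_sign_of_ne_zero (hG0 k hk)).comp_continuousWithinAt (hG k hk)
  refine ⟨SignType.sign (G k₁), fun k hk ψ hψ => ?_⟩
  rw [sign_mul_eq_parity hM hMM (hA k hk) (hE.simple k hk) hψ]
  exact hR.constant hsign hk hk₁

end

/-- Where two bands meet, there are momenta at which both are as close to the meeting point as one
likes. -/
theorem MeetAt.exists_near {R : Set Momentum} {E₁ E₂ : Momentum → ℝ} {k₀ : Momentum} {E₀ : ℝ}
    (h : MeetAt R E₁ E₂ k₀ E₀) {ε : ℝ} (hε : 0 < ε) :
    ∃ k ∈ R, dist k k₀ < ε ∧ |E₁ k - E₀| < ε ∧ |E₂ k - E₀| < ε := by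
  have := mem_closure_iff_nhdsWithin_neBot.1 h.mem_closure
  have hd : ∀ᶠ k in 𝓝[R] k₀, dist k k₀ < ε := mem_nhdsWithin_of_mem_nhds (Metric.ball_mem_nhds _ hε)
  have h1 := Metric.tendsto_nhds.1 h.tendsto_fst ε hε
  have h2 := Metric.tendsto_nhds.1 h.tendsto_snd ε hε
  obtain ⟨k, hkR, hk, hk1, hk2⟩ := (eventually_mem_nhdsWithin.and (hd.and (h1.and h2))).exists
  exact ⟨k, hkR, hk, by rwa [Real.dist_eq] at hk1, by rwa [Real.dist_eq] at hk2⟩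

end MirrorAdjoint

/-! ### Exceptional points, exceptional lines and non-defective degeneracies -/

theorem mainTheorem5 {N : ℕ} (n : MirrorAdjoint.Momentum) (hn : ‖n‖ = 1)
    (Λ : AddSubgroup MirrorAdjoint.Momentum)
    (M : Matrix (Fin N) (Fin N) ℂ) (hM : M.IsHermitian) (hMM : M * M = 1)
    (H : MirrorAdjoint.Momentum → Matrix (Fin N) (Fin N) ℂ) (hcont : Continuous H)
    (hper : ∀ k, ∀ g ∈ Λ, H (k + g) = H k)
    (hsym : MirrorAdjoint.MirrorAdjointSymmetric n M H) :
    -- near a real order-2 exceptional point on the mirror plane, any two states with distinct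
    -- real energies close to that of the exceptional point have opposite parities
    (∀ k₀ ∈ MirrorAdjoint.mirrorPlane n Λ, ∀ E₀ : ℝ, MirrorAdjoint.IsEP2 (H k₀) (E₀ : ℂ) →
      ∃ ε > 0, ∀ k ∈ MirrorAdjoint.mirrorPlane n Λ, dist k k₀ < ε →
        ∀ E₁ E₂ : ℝ, E₁ ≠ E₂ → |E₁ - E₀| < ε → |E₂ - E₀| < ε →
        ∀ ψ₁ ψ₂ : Fin N → ℂ, MirrorAdjoint.IsEigenstate (H k) (E₁ : ℂ) ψ₁ →
          MirrorAdjoint.IsEigenstate (H k) (E₂ : ℂ) ψ₂ →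
          MirrorAdjoint.parity M ψ₁ ≠ 0 ∧
            MirrorAdjoint.parity M ψ₂ = -MirrorAdjoint.parity M ψ₁) ∧
    -- an order-2 exceptional line on the mirror plane is formed by two bands that have opposite
    -- parities in the adjacent exact phase
    (∀ (I : Set ℝ) (γ : ℝ → MirrorAdjoint.Momentum) (e : ℝ → ℝ),
      MirrorAdjoint.IsExceptionalLine n Λ H I γ e →
      ∀ (R : Set MirrorAdjoint.Momentum) (E₁ E₂ : MirrorAdjoint.Momentum → ℝ),
        IsPreconnected R → MirrorAdjoint.IsExactBandPair n Λ H R E₁ E₂ →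
        ∀ t ∈ I, MirrorAdjoint.MeetAt R E₁ E₂ (γ t) (e t) →
        ∃ s : SignType, s ≠ 0 ∧ MirrorAdjoint.BandHasParity M H R E₁ s ∧
          MirrorAdjoint.BandHasParity M H R E₂ (-s)) ∧
    -- a degeneracy, adjacent to the exact phase, of two bands with equal parities is non-defective
    (∀ (R : Set MirrorAdjoint.Momentum) (E₁ E₂ : MirrorAdjoint.Momentum → ℝ),
      MirrorAdjoint.IsExactBandPair n Λ H R E₁ E₂ →
      (∀ k ∈ R, ∀ ψ₁ ψ₂ : Fin N → ℂ, MirrorAdjoint.IsEigenstate (H k) (E₁ k : ℂ) ψ₁ →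
        MirrorAdjoint.IsEigenstate (H k) (E₂ k : ℂ) ψ₂ →
        MirrorAdjoint.parity M ψ₁ = MirrorAdjoint.parity M ψ₂) →
      ∀ (k₀ : MirrorAdjoint.Momentum) (E₀ : ℝ), k₀ ∈ MirrorAdjoint.mirrorPlane n Λ →
        MirrorAdjoint.algMult (H k₀) (E₀ : ℂ) = 2 →
        MirrorAdjoint.MeetAt R E₁ E₂ k₀ E₀ →
        MirrorAdjoint.NonDefective (H k₀) (E₀ : ℂ)) := by
  have hA : ∀ k ∈ MirrorAdjoint.mirrorPlane n Λ, M * (H k)ᴴ * M = H k := fun k hk =>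
    MirrorAdjoint.symm_of_mem_mirrorPlane hMM hper hsym hk
  refine ⟨fun k₀ hk₀ E₀ hEP => ?_, ?_, ?_⟩
  · obtain ⟨ε, hε, h⟩ := MirrorAdjoint.exists_opposite_parity hM hMM hcont (hA k₀ hk₀) hEP
    exact ⟨ε, hε, fun k hk => h k (hA k hk)⟩
  · intro I γ e hline R E₁ E₂ hR hpair t ht hmeet
    have hAR : ∀ k ∈ R, M * (H k)ᴴ * M = H k := fun k hk => hA k (hpair.subset_mirrorPlane hk)
    obtain ⟨s₁, hs₁⟩ := hpair.exact_fst.exists_bandHasParity hM hMM hcont hR hAR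
    obtain ⟨s₂, hs₂⟩ := hpair.exact_snd.exists_bandHasParity hM hMM hcont hR hAR
    obtain ⟨ε, hε, h⟩ := MirrorAdjoint.exists_opposite_parity hM hMM hcont
      (hA _ (hline.mem_mirrorPlane t ht)) (hline.isEP2 t ht)
    obtain ⟨k, hkR, hk, hk1, hk2⟩ := hmeet.exists_near hε
    obtain ⟨ψ₁, hψ₁⟩ := MirrorAdjoint.exists_isEigenstate
      (hpair.exact_fst.simple k hkR ▸ one_ne_zero)
    obtain ⟨ψ₂, hψ₂⟩ := MirrorAdjoint.exists_isEigenstate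
      (hpair.exact_snd.simple k hkR ▸ one_ne_zero)
    have hp := h k (hAR k hkR) hk _ _ (hpair.ne k hkR) hk1 hk2 ψ₁ ψ₂ hψ₁ hψ₂
    -- Each band has one parity on all of `R`, so comparing them at a single momentum near the line
    -- suffices.
    rw [hs₁ k hkR ψ₁ hψ₁, hs₂ k hkR ψ₂ hψ₂] at hp
    exact ⟨s₁, hp.1, hs₁, hp.2 ▸ hs₂⟩
  · intro R E₁ E₂ hpair hpar k₀ E₀ hk₀ halg hmeet
    by_contra hdef
    have hle := MirrorAdjoint.geomMult_le_algMult (H k₀) (E₀ : ℂ)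
    obtain ⟨ψ, hψ⟩ := MirrorAdjoint.exists_isEigenstate (halg ▸ two_ne_zero)
    have hpos := hψ.geomMult_pos
    rw [MirrorAdjoint.NonDefective] at hdef
    -- A defective eigenvalue of algebraic multiplicity 2 has geometric multiplicity 1, so it is an
    -- exceptional point and nearby parities would be opposite and nonzero.
    obtain ⟨ε, hε, h⟩ := MirrorAdjoint.exists_opposite_parity hM hMM hcont (hA k₀ hk₀)
      ⟨halg, by omega⟩
    obtain ⟨k, hkR, hk, hk1, hk2⟩ := hmeet.exists_near hε
    obtain ⟨ψ₁, hψ₁⟩ := MirrorAdjoint.exists_isEigenstate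
      (hpair.exact_fst.simple k hkR ▸ one_ne_zero)
    obtain ⟨ψ₂, hψ₂⟩ := MirrorAdjoint.exists_isEigenstate
      (hpair.exact_snd.simple k hkR ▸ one_ne_zero)
    have hp := h k (hA k (hpair.subset_mirrorPlane hkR)) hk _ _ (hpair.ne k hkR) hk1 hk2
      ψ₁ ψ₂ hψ₁ hψ₂
    rw [← hpar k hkR ψ₁ ψ₂ hψ₁ hψ₂] at hp
    exact hp.1 (SignType.self_eq_neg_iff.1 hp.2)
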